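/- Let $(F_n)$ be the Fibonacci numbers, $F_0=0$, $F_1=1$, $F_{n+1}=F_n+F_{n-1}$, and $(G_n)$ the Pell numbers, $G_0=0$, $G_1=1$, $G_{n+1}=2G_n+G_{n-1}$. Let $k$ and $d$ be integers such that $\dfrac{4d^2}{k-d^2}$ is a negative integer. Then the negative Pell equation $p^2-kq^2=-1$ has no solutions in integers $p,q$, unless $(k,d)$ is one of the following exceptional pairs, where $s$ denotes an integer (positive or negative) and $n\ge 0$ an integer: - $k=5s^2$ and $d=3s$ or $d=5s$, where $2s$ divides $F_{2n+1}$ for some $n$; - $k=2s^2$ and $d=2s$, where $s$ divides $G_{2n+1}$ for some $n$. For each of these exceptional pairs, the equation $p^2-kq^2=-1$ does have a solution in integers. -/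

import Mathlib

/-- The Pell numbers: `G₀ = 0`, `G₁ = 1`, `Gₙ₊₂ = 2 Gₙ₊₁ + Gₙ`. -/
def pellNumber : ℕ → ℕ
  | 0 => 0
  | 1 => 1
  | n + 2 => 2 * pellNumber (n + 1) + pellNumber n

/-- The exceptional pairs `(k, d)`. The scale `s` is an integer of either sign, so that the pairs
`(k, d)` and `(k, -d)` are treated alike; `s ≠ 0` is automatic, since `s` divides a nonzero
integer. The Fibonacci numbers `Nat.fib` start with `F₀ = 0`, `F₁ = 1`. -/
def IsExceptionalPair (k d : ℤ) : Prop :=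
  (∃ (s : ℤ) (n : ℕ), k = 5 * s ^ 2 ∧ (d = 3 * s ∨ d = 5 * s) ∧
    2 * s ∣ (Nat.fib (2 * n + 1) : ℤ)) ∨
  (∃ (s : ℤ) (n : ℕ), k = 2 * s ^ 2 ∧ d = 2 * s ∧ s ∣ (pellNumber (2 * n + 1) : ℤ))

/-!
A solution of `p² - k q² = -1` turns `4 d² = m (d² - k)` into `(a + b)² = m (a b - 1)` with
`a = d q + p` and `b = d q - p`. For fixed `b` this is a quadratic equation in `a`, so Vieta jumping
descends to the smallest solutions `(2, 1)`, `(3, 1)` and `(3, 2)`, whence `m` is `9`, `8` or `5`,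
and `k` is `5 s²` or `2 s²`. For these `k` the negative Pell equation becomes
`x² + c x y - y² = -1` with `c = 1` or `c = 2`, which is solved by consecutive Fibonacci or Pell
numbers.
-/

section VietaJumping

variable {a b m : ℤ}

theorem ne_of_add_sq_eq (hb : 0 < b) (h : (a + b) ^ 2 = m * (a * b - 1)) : a ≠ b := by
  rintro rfl
  have hdvd : a * a - 1 ∣ 4 := ⟨m - 4, by linear_combination h⟩
  have hle : a * a - 1 ≤ 4 := Int.le_of_dvd four_pos hdvd
  have ha2 : a ≤ 2 := by nlinarith
  interval_cases a <;> omega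

theorem eq_five_or_eight_or_nine_of_add_sq_eq_of_sq_le (hb : 0 < b) (hba : b < a)
    (h : (a + b) ^ 2 = m * (a * b - 1)) (hmin : a ^ 2 ≤ b ^ 2 + m) :
    m = 5 ∨ m = 8 ∨ m = 9 := by
  have hab : 0 < a * b - 1 := by nlinarith
  have hle : (a - b) * (a * b - 1) ≤ a + b := by
    refine le_of_mul_le_mul_left ?_ (by linarith : 0 < a + b)
    calc (a + b) * ((a - b) * (a * b - 1)) = (a ^ 2 - b ^ 2) * (a * b - 1) := by ring
      _ ≤ m * (a * b - 1) := by gcongr; linarith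
      _ = (a + b) * (a + b) := by rw [← h, sq]
  have hprod : (a - 1) * (b - 1) ≤ 2 := by nlinarith
  have ha3 : a ≤ 3 := by nlinarith
  have ha2 : 2 ≤ a := by linarith
  interval_cases a <;> interval_cases b <;> omega

theorem eq_five_or_eight_or_nine_of_add_sq_eq_of_pos (ha : 0 < a) (hb : 0 < b)
    (h : (a + b) ^ 2 = m * (a * b - 1)) : m = 5 ∨ m = 8 ∨ m = 9 := by
  induction hN : (a + b).toNat using Nat.strong_induction_on generalizing a b with
  | _ N ih =>
    wlog hba : b ≤ a generalizing a b
    · exact this hb ha (by linear_combination h) (by rwa [add_comm]) (by omega)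
    have hm : 0 < m := by nlinarith [mul_pos ha hb]
    have hne : a ≠ b := ne_of_add_sq_eq hb h
    rcases le_or_gt (a ^ 2) (b ^ 2 + m) with hmin | hlt
    · exact eq_five_or_eight_or_nine_of_add_sq_eq_of_sq_le hb (by omega) h hmin
    -- the other root of the quadratic equation for `a`
    set a' := (m - 2) * b - a
    have hvieta : a * a' = b ^ 2 + m := by linear_combination -h
    have ha'_pos : 0 < a' := pos_of_mul_pos_right (hvieta ▸ by positivity) ha.le
    have ha'_lt : a' < a := by nlinarith
    exact ih _ (by omega) ha'_pos hb (by linear_combination h) rfl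

theorem eq_five_or_eight_or_nine_of_add_sq_eq (hm : 0 < m) (h : (a + b) ^ 2 = m * (a * b - 1)) :
    m = 5 ∨ m = 8 ∨ m = 9 := by
  have hab : 0 < a * b := by
    have : 0 ≤ a * b - 1 := nonneg_of_mul_nonneg_right (h ▸ sq_nonneg (a + b)) hm
    omega
  rcases mul_pos_iff.1 hab with ⟨ha, hb⟩ | ⟨ha, hb⟩
  · exact eq_five_or_eight_or_nine_of_add_sq_eq_of_pos ha hb h
  · exact eq_five_or_eight_or_nine_of_add_sq_eq_of_pos (neg_pos.2 ha) (neg_pos.2 hb)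
      (by linear_combination h)

end VietaJumping

/-- The Lucas sequence `Uₙ(c, -1)`, a common generalization of the Fibonacci numbers (`c = 1`) and
the Pell numbers (`c = 2`). -/
def lucasU (c : ℤ) : ℕ → ℤ
  | 0 => 0
  | 1 => 1
  | n + 2 => c * lucasU c (n + 1) + lucasU c n

section LucasU

theorem lucasU_one_eq_fib (n : ℕ) : lucasU 1 n = Nat.fib n := by
  induction n using Nat.twoStepInduction with
  | zero => rfl
  | one => rfl
  | more n ih ih' => rw [lucasU, ih, ih', Nat.fib_add_two]; push_cast; ring

theorem lucasU_two_eq_pellNumber (n : ℕ) : lucasU 2 n = pellNumber n := by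
  induction n using Nat.twoStepInduction with
  | zero => rfl
  | one => rfl
  | more n ih ih' => rw [lucasU, ih, ih', pellNumber]; push_cast; ring

theorem lucasU_cassini (c : ℤ) (n : ℕ) :
    lucasU c (2 * n) ^ 2 + c * lucasU c (2 * n) * lucasU c (2 * n + 1) - lucasU c (2 * n + 1) ^ 2
      = -1 := by
  induction n with
  | zero => simp [lucasU]
  | succ n ih =>
    simp only [mul_add_one, lucasU]
    linear_combination ih

variable {c x y : ℤ}

theorem exists_eq_lucasU_of_nonneg (hc : 0 < c) (hx : 0 ≤ x) (hy : 0 < y)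
    (h : x ^ 2 + c * x * y - y ^ 2 = -1) :
    ∃ n, x = lucasU c (2 * n) ∧ y = lucasU c (2 * n + 1) := by
  induction hN : x.toNat using Nat.strong_induction_on generalizing x y with
  | _ N ih =>
    rcases hx.eq_or_lt with rfl | hx
    · exact ⟨0, rfl, by simp only [lucasU]; nlinarith⟩
    -- run the recurrence two steps backwards
    set y' := y - c * x
    set x' := x - c * y'
    have hyy' : y * y' = x ^ 2 + 1 := by linear_combination -h
    have hy'_pos : 0 < y' := pos_of_mul_pos_right (hyy' ▸ by positivity) hy.le
    have hx'_nonneg : 0 ≤ x' := by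
      by_contra! hneg
      have hle : (x + 1) * y ≤ c * (x ^ 2 + 1) := by
        calc (x + 1) * y ≤ c * y' * y := by gcongr; linarith
          _ = c * (x ^ 2 + 1) := by rw [← hyy']; ring
      have hlt : c * (x ^ 2 + 1) < (x + 1) * y := by
        calc c * (x ^ 2 + 1) < (x + 1) * (c * x + 1) := by nlinarith
          _ ≤ (x + 1) * y := by gcongr; linarith
      exact hlt.not_ge hle
    have hx'_lt : x' < x := sub_lt_self _ (mul_pos hc hy'_pos)
    obtain ⟨n, hxn, hyn⟩ := ih _ (by omega) hx'_nonneg hy'_pos (by linear_combination h) rfl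
    refine ⟨n + 1, ?_, ?_⟩ <;> simp only [mul_add_one, lucasU, ← hxn, ← hyn] <;> ring

theorem exists_eq_or_neg_eq_lucasU (hc : 0 < c) (h : x ^ 2 + c * x * y - y ^ 2 = -1) :
    ∃ n, y = lucasU c (2 * n + 1) ∨ -y = lucasU c (2 * n + 1) := by
  wlog hy : 0 < y generalizing x y
  · have hy0 : y ≠ 0 := by
      rintro rfl
      nlinarith
    obtain ⟨n, hn⟩ := this (x := -x) (y := -y) (by linear_combination h) (by omega)
    exact ⟨n, by rwa [neg_neg, or_comm] at hn⟩
  rcases le_or_gt 0 x with hx | hx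
  · obtain ⟨n, -, hn⟩ := exists_eq_lucasU_of_nonneg hc hx hy h
    exact ⟨n, .inl hn⟩
  · -- the other root of the quadratic equation for `x`
    have hx' : 0 ≤ -x - c * y := by nlinarith
    obtain ⟨n, -, hn⟩ := exists_eq_lucasU_of_nonneg hc hx' hy (by linear_combination h)
    exact ⟨n, .inl hn⟩

theorem exists_dvd_lucasU_iff (hc : 0 < c) (t : ℤ) :
    (∃ n, t ∣ lucasU c (2 * n + 1)) ↔ ∃ x z : ℤ, x ^ 2 + c * x * (t * z) - (t * z) ^ 2 = -1 := by
  constructor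
  · rintro ⟨n, z, hz⟩
    exact ⟨lucasU c (2 * n), z, hz ▸ lucasU_cassini c n⟩
  · rintro ⟨x, z, h⟩
    obtain ⟨n, hn | hn⟩ := exists_eq_or_neg_eq_lucasU hc h
    · exact ⟨n, hn ▸ dvd_mul_right t z⟩
    · exact ⟨n, hn ▸ (dvd_mul_right t z).neg_right⟩

end LucasU

section NegativePell

theorem exists_negative_pell_five_iff (s : ℤ) :
    (∃ p q : ℤ, p ^ 2 - 5 * s ^ 2 * q ^ 2 = -1) ↔ ∃ n, 2 * s ∣ (Nat.fib (2 * n + 1) : ℤ) := by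
  simp only [← lucasU_one_eq_fib, exists_dvd_lucasU_iff one_pos]
  constructor
  · rintro ⟨p, q, h⟩
    exact ⟨p - s * q, q, by linear_combination h⟩
  · rintro ⟨x, z, h⟩
    exact ⟨x + s * z, z, by linear_combination h⟩

theorem exists_negative_pell_two_iff (s : ℤ) :
    (∃ p q : ℤ, p ^ 2 - 2 * s ^ 2 * q ^ 2 = -1) ↔ ∃ n, s ∣ (pellNumber (2 * n + 1) : ℤ) := by
  simp only [← lucasU_two_eq_pellNumber, exists_dvd_lucasU_iff two_pos]
  constructor
  · rintro ⟨p, q, h⟩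
    exact ⟨p - s * q, q, by linear_combination h⟩
  · rintro ⟨x, z, h⟩
    exact ⟨x + s * z, z, by linear_combination h⟩

variable {k d m : ℤ}

theorem eq_five_mul_sq_or_eq_two_mul_sq (hm : 0 < m) (hmk : 4 * d ^ 2 = m * (d ^ 2 - k))
    (hsol : ∃ p q : ℤ, p ^ 2 - k * q ^ 2 = -1) :
    (∃ s, k = 5 * s ^ 2 ∧ (d = 3 * s ∨ d = 5 * s)) ∨ ∃ s, k = 2 * s ^ 2 ∧ d = 2 * s := by
  obtain ⟨p, q, h⟩ := hsol
  have hjump : ((d * q + p) + (d * q - p)) ^ 2 = m * ((d * q + p) * (d * q - p) - 1) := by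
    linear_combination q ^ 2 * hmk + m * h
  rcases eq_five_or_eight_or_nine_of_add_sq_eq hm hjump with rfl | rfl | rfl
  · obtain ⟨s, rfl⟩ : 5 ∣ d := Prime.dvd_of_dvd_pow (n := 2) (by norm_num) (by omega)
    exact .inl ⟨s, by linarith, .inr rfl⟩
  · obtain ⟨s, rfl⟩ : 2 ∣ d := Prime.dvd_of_dvd_pow (n := 2) (by norm_num) (by omega)
    exact .inr ⟨s, by linarith, rfl⟩
  · obtain ⟨s, rfl⟩ : 3 ∣ d := Prime.dvd_of_dvd_pow (n := 2) (by norm_num) (by omega)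
    exact .inl ⟨s, by linarith, .inl rfl⟩

end NegativePell

theorem IsExceptionalPair.exists_negative_pell {k d : ℤ} (h : IsExceptionalPair k d) :
    ∃ p q : ℤ, p ^ 2 - k * q ^ 2 = -1 := by
  rcases h with ⟨s, n, rfl, -, hn⟩ | ⟨s, n, rfl, -, hn⟩
  · exact (exists_negative_pell_five_iff s).2 ⟨n, hn⟩
  · exact (exists_negative_pell_two_iff s).2 ⟨n, hn⟩

theorem isExceptionalPair_of_exists_negative_pell {k d m : ℤ} (hm : 0 < m)
    (hmk : 4 * d ^ 2 = m * (d ^ 2 - k)) (hsol : ∃ p q : ℤ, p ^ 2 - k * q ^ 2 = -1) :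
    IsExceptionalPair k d := by
  rcases eq_five_mul_sq_or_eq_two_mul_sq hm hmk hsol with ⟨s, rfl, hd⟩ | ⟨s, rfl, hd⟩
  · obtain ⟨n, hn⟩ := (exists_negative_pell_five_iff s).1 hsol
    exact .inl ⟨s, n, rfl, hd, hn⟩
  · obtain ⟨n, hn⟩ := (exists_negative_pell_two_iff s).1 hsol
    exact .inr ⟨s, n, rfl, hd, hn⟩

theorem corollary6p8 (k d : ℤ)
    (hR : ∃ r : ℤ, r < 0 ∧ (4 * (d : ℚ) ^ 2) / ((k : ℚ) - (d : ℚ) ^ 2) = (r : ℚ)) :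
    (¬ IsExceptionalPair k d → ¬ ∃ p q : ℤ, p ^ 2 - k * q ^ 2 = -1) ∧
      (IsExceptionalPair k d → ∃ p q : ℤ, p ^ 2 - k * q ^ 2 = -1) := by
  obtain ⟨r, hr, hrq⟩ := hR
  -- a zero denominator would give the quotient the junk value `0`
  have hden : (k : ℚ) - d ^ 2 ≠ 0 := by
    intro h0
    rw [h0, div_zero] at hrq
    exact hr.ne' (by exact_mod_cast hrq)
  have hmk : 4 * d ^ 2 = -r * (d ^ 2 - k) := by
    rw [div_eq_iff hden] at hrq
    have : 4 * d ^ 2 = r * (k - d ^ 2) := by exact_mod_cast hrq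
    linear_combination this
  exact ⟨mt (isExceptionalPair_of_exists_negative_pell (neg_pos.2 hr) hmk),
    IsExceptionalPair.exists_negative_pell⟩
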